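/- Let $G$ be a finite simple connected graph with $m$ edges and let $k\ge 1$. Let $S_k(G)$ be the graph obtained from $G$ by replacing each edge $st$ by $k$ parallel paths of length $2$: each edge $st$ is deleted and $k$ new vertices are added, each adjacent exactly to $s$ and $t$. Let $N$ be the set of all $km$ new vertices, so that $V(S_k(G))=V(G)\cup N$. For a finite connected graph $H$, let $E_iT_j(H)$ be the expected hitting time of the simple random walk on $H$, i.e. the expectation of $T_j=\min\{n\ge 0: X_n=j\}$ for the walk $(X_n)_{n\ge0}$ with $X_0=i$ which at each step moves to a uniformly chosen neighbour of its current position (if $H$ has a single vertex, the walk stays there); in particular $E_iT_i(H)=0$. Theorem. All the expected hitting times $E_iT_j(G)$ and $E_iT_j(S_k(G))$ are finite, and the following hold. 1. If $i,j\in V(G)$, then $$E_iT_j(S_k(G))=4E_iT_j(G).$$ 2. If $i\in N$ has the neighbours $N_{S_k(G)}(i)=\{s,t\}$ and $j\in V(G)$, then $$E_iT_j(S_k(G))=1+2E_sT_j(G)+2E_tT_j(G),$$ $$E_jT_i(S_k(G))=2km-1+2\big[E_jT_s(G)+E_jT_t(G)\big]-\big[E_tT_s(G)+E_sT_t(G)\big].$$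 3. If $i,j\in N$ are distinct, with $N_{S_k(G)}(i)=\{s,t\}$ and $N_{S_k(G)}(j)=\{p,q\}$, then $$E_iT_j(S_k(G))=2km+E_sT_p(G)+E_sT_q(G)+E_tT_p(G)+E_tT_q(G)-E_qT_p(G)-E_pT_q(G),$$ $$E_jT_i(S_k(G))=2km+E_pT_s(G)+E_qT_s(G)+E_pT_t(G)+E_qT_t(G)-E_tT_s(G)-E_sT_t(G).$$ -/

import Mathlib

open MeasureTheory ProbabilityTheory
open scoped ENNReal

namespace SimpleGraph

/-- The `k`-parallel subdivision `S_k(G)`: every edge of `G` is replaced by `k` parallel paths of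
length two. The vertices are the original vertices `Sum.inl v` and, for every edge `e` of `G` and
every `c : Fin k`, a new vertex `Sum.inr (e, c)`, which is joined exactly to the two ends of `e`. -/
def parallelSubdivision {V : Type*} (G : SimpleGraph V) (k : ℕ) :
    SimpleGraph (V ⊕ (G.edgeSet × Fin k)) where
  Adj
    | Sum.inl v, Sum.inr (e, _) => v ∈ (e : Sym2 V)
    | Sum.inr (e, _), Sum.inl v => v ∈ (e : Sym2 V)
    | _, _ => False
  symm := ⟨by rintro (v | ⟨e, c⟩) (w | ⟨f, d⟩) h <;> exact h⟩
  loopless := ⟨by rintro (v | ⟨e, c⟩) h <;> exact h⟩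

open Classical in
/-- One step of the simple random walk on a finite graph: from `v`, move to a uniformly chosen
neighbour of `v`. At an isolated vertex the walk stays where it is. -/
noncomputable def stepDistribution {V : Type*} [Finite V] (G : SimpleGraph V) (v : V) : PMF V :=
  if h : (G.neighborSet v).Nonempty then
    PMF.uniformOfFinset (Set.toFinite (G.neighborSet v)).toFinset
      ((Set.Finite.toFinset_nonempty _).mpr h)
  else PMF.pure v

/-- The transition kernel of the simple random walk. -/
noncomputable def stepKernel {V : Type*} [Finite V] [MeasurableSpace V]
    [DiscreteMeasurableSpace V] (G : SimpleGraph V) : Kernel V V where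
  toFun v := (G.stepDistribution v).toMeasure
  measurable' := Measurable.of_discrete

instance {V : Type*} [Finite V] [MeasurableSpace V] [DiscreteMeasurableSpace V]
    (G : SimpleGraph V) : IsMarkovKernel G.stepKernel :=
  ⟨fun v => PMF.toMeasure.isProbabilityMeasure (G.stepDistribution v)⟩

/-- The transition at time `n`, as a kernel from histories `(x_0, …, x_n)` to `x_{n+1}`: it
depends on the history only through the present position `x_n`. -/
noncomputable def historyKernel {V : Type*} [Finite V] [MeasurableSpace V]
    [DiscreteMeasurableSpace V] (G : SimpleGraph V) (n : ℕ) :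
    Kernel (∀ _ : Finset.Iic n, V) V :=
  G.stepKernel.comap (fun x => x ⟨n, Finset.mem_Iic.mpr le_rfl⟩) (measurable_pi_apply _)

instance {V : Type*} [Finite V] [MeasurableSpace V] [DiscreteMeasurableSpace V]
    (G : SimpleGraph V) (n : ℕ) : IsMarkovKernel (G.historyKernel n) := by
  unfold historyKernel; infer_instance

/-- The law, on the space of trajectories `ℕ → V`, of the simple random walk on `G` that starts
at `i`. -/
noncomputable def walkLaw {V : Type*} [Finite V] [MeasurableSpace V]
    [DiscreteMeasurableSpace V] (G : SimpleGraph V) (i : V) : Measure (ℕ → V) :=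
  Kernel.traj (X := fun _ => V) G.historyKernel 0 (fun _ => i)

/-- The hitting time `T_j` of a trajectory: the least `n ≥ 0` such that the trajectory is at `j`
at time `n`, and `⊤` if there is none. -/
noncomputable def hittingTime {V : Type*} (j : V) : (ℕ → V) → ℕ∞ :=
  hittingAfter (fun (n : ℕ) (x : ℕ → V) => x n) {j} 0

/-- The expected hitting time `E_i T_j(G)`, as an extended nonnegative real. -/
noncomputable def expectedHittingTime {V : Type*} [Finite V] (G : SimpleGraph V) (i j : V) :
    ℝ≥0∞ :=
  letI : MeasurableSpace V := ⊤
  ∫⁻ x, (hittingTime j x : ℝ≥0∞) ∂(G.walkLaw i)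

/-- The real number `E_i T_j(G)`; this is meaningful when `expectedHittingTime` is finite. -/
noncomputable def hit {V : Type*} [Finite V] (G : SimpleGraph V) (i j : V) : ℝ :=
  (G.expectedHittingTime i j).toReal

end SimpleGraph

/-! On a finite connected graph the hitting times of `j` are characterised by `f j = 0` and, at
every `v ≠ j`, `f v = 1 +` the average of `f` over the neighbours of `v`
(`IsHittingSolution.hit_eq`). It therefore suffices to exhibit solutions on `S_k(G)`. Away from the
target, the equation at a new vertex with ends `s`, `t` forces the value `1 + (a s + a t) / 2`,
where `a` is the restriction to `V`. The equation at `u ∈ V` then reduces to `∑ (a u - a w - 4) = 0`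
over the `G`-neighbours `w` of `u`, so an original target `j` gives `a = 4 E_·T_j(G)`. For a new
target with ends `s`, `t`, take `a = 2 (E_·T_s + E_·T_t) + const`. By `sum_hit_sub_hit` the
equations on `V` fail only at `s` and `t`, by `-2km` each; lowering the value at the target by `2km`
repairs both, and the constant makes that value zero. -/

namespace SimpleGraph

open Finset Filter Topology Preorder

/-! ### From the law of the walk to the one-step equations -/

section Walk

variable {V : Type*}

section Law

variable [Finite V] [MeasurableSpace V] [DiscreteMeasurableSpace V] (G : SimpleGraph V)

instance (i : V) : IsProbabilityMeasure (G.walkLaw i) := by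
  unfold walkLaw; infer_instance

/-- The simple random walk starts at its initial vertex. -/
theorem ae_walkLaw_zero (i : V) : ∀ᵐ x ∂(G.walkLaw i), x 0 = i := by
  have h := Kernel.traj_map_frestrictLe_apply (X := fun _ => V) (κ := G.historyKernel) 0 0
    (fun _ => i)
  rw [Kernel.partialTraj_self, Kernel.id_apply] at h
  have h' : ∀ᵐ y ∂((G.walkLaw i).map (frestrictLe 0)),
      y ⟨0, Finset.mem_Iic.mpr le_rfl⟩ = i := by
    unfold walkLaw
    rw [h, ae_dirac_iff (MeasurableSet.of_discrete)]
  exact ae_of_ae_map (measurable_frestrictLe 0).aemeasurable h'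

/-- The Markov property of the simple random walk at a fixed time. -/
theorem lintegral_walkLaw_succ (i : V) (n : ℕ) (φ : (∀ _ : Finset.Iic n, V) → ℝ≥0∞)
    (ψ : V → ℝ≥0∞) :
    ∫⁻ x, φ (frestrictLe n x) * ψ (x (n + 1)) ∂(G.walkLaw i)
      = ∫⁻ x, φ (frestrictLe n x) * ∫⁻ w, ψ w ∂(G.stepKernel (x n)) ∂(G.walkLaw i) := by
  have hφ : Measurable φ := Measurable.of_discrete
  have hψ : Measurable ψ := Measurable.of_discrete
  -- Split the trajectory law at time `n` into the history and its continuation.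
  have key := Kernel.partialTraj_compProd_traj (X := fun _ => V) (κ := G.historyKernel)
    (Nat.zero_le n) (fun _ => i)
  have hm : Measurable fun p : (∀ _ : Finset.Iic n, V) × (ℕ → V) => φ p.1 * ψ (p.2 (n + 1)) := by
    fun_prop
  have hstep : ∀ y : (∀ _ : Finset.Iic n, V),
      ∫⁻ z, ψ (z (n + 1)) ∂(Kernel.traj (X := fun _ => V) G.historyKernel n y)
        = ∫⁻ w, ψ w ∂(G.stepKernel (y ⟨n, Finset.mem_Iic.mpr le_rfl⟩)) := by
    intro y
    have h1 := Kernel.map_traj_succ_self (X := fun _ => V) (κ := G.historyKernel) (a := n)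
    have h2 : (Kernel.traj (X := fun _ => V) G.historyKernel n y).map (fun x => x (n + 1))
        = G.historyKernel n y := by
      rw [← Kernel.map_apply _ (by fun_prop), h1]
    rw [← lintegral_map (f := ψ) (g := fun x : ℕ → V => x (n + 1)) hψ (by fun_prop), h2]
    rfl
  have hL : ∫⁻ x, φ (frestrictLe n x) * ψ (x (n + 1)) ∂(G.walkLaw i)
      = ∫⁻ p, φ p.1 * ψ (p.2 (n + 1)) ∂((G.walkLaw i).map (fun x => (frestrictLe n x, x))) := by
    rw [lintegral_map hm (by fun_prop)]
  unfold walkLaw at hL ⊢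
  rw [hL, ← key, Measure.lintegral_compProd hm]
  have : ∀ y : (∀ _ : Finset.Iic n, V),
      ∫⁻ z, φ y * ψ (z (n + 1)) ∂(Kernel.traj (X := fun _ => V) G.historyKernel n y)
        = φ y * ∫⁻ w, ψ w ∂(G.stepKernel (y ⟨n, Finset.mem_Iic.mpr le_rfl⟩)) := by
    intro y
    rw [lintegral_const_mul _ (by fun_prop), hstep]
  simp only [this]
  rw [← Kernel.traj_map_frestrictLe_apply, lintegral_map Measurable.of_discrete (by fun_prop)]
  rfl

end Law

/-- The `n`-th tail event `T_j > n`, as a function with values `0` and `1`. -/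
noncomputable def avoids (j : V) (n : ℕ) (x : ℕ → V) : ℝ≥0∞ :=
  open Classical in if ∀ m ≤ n, x m ≠ j then 1 else 0

/-- The tail-sum formula, trajectory by trajectory; if `j` is never hit, both sides are `⊤`. -/
theorem hittingTime_eq_tsum (j : V) (x : ℕ → V) :
    (hittingTime j x : ℝ≥0∞) = ∑' n, avoids j n x := by
  classical
  by_cases h : ∃ m, x m = j
  · have hl : ∀ n, (∀ m ≤ n, x m ≠ j) ↔ n < Nat.find h := by
      intro n
      rw [Nat.lt_find_iff]
    have ht : hittingTime j x = (Nat.find h : ℕ∞) := by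
      unfold hittingTime
      rw [hittingAfter_def]
      have h' : ∃ m, 0 ≤ m ∧ x m ∈ ({j} : Set V) := by simpa using h
      simp only [if_pos h']
      have : sInf {m | 0 ≤ m ∧ x m ∈ ({j} : Set V)} = Nat.find h :=
        IsLeast.csInf_eq ⟨⟨Nat.zero_le _, Nat.find_spec h⟩, fun m hm => Nat.find_min' h hm.2⟩
      rw [this]
      rfl
    rw [ht, tsum_eq_sum (s := Finset.range (Nat.find h))]
    · rw [Finset.sum_congr rfl (g := fun _ => 1)]
      · simp
      · intro n hn
        rw [avoids, if_pos ((hl n).2 (Finset.mem_range.1 hn))]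
    · intro n hn
      rw [avoids, if_neg (fun hc => hn (Finset.mem_range.2 ((hl n).1 hc)))]
  · have ht : hittingTime j x = ⊤ := by
      unfold hittingTime
      exact hittingAfter_eq_top_iff.2 fun m _ hm => h ⟨m, hm⟩
    have h1 : ∀ n, avoids j n x = 1 := fun n => if_pos fun m _ hm => h ⟨m, hm⟩
    simp [ht, h1]

/-- If a nonnegative function `f` vanishes at `j` and satisfies `f = 1 + P f` away from `j`, where
`P` is the transition operator of the walk, then `f` is the expected hitting time of `j`. -/
theorem expectedHittingTime_eq_of_step [Finite V] (G : SimpleGraph V) (j : V) (f : V → ℝ≥0∞)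
    (hf : ∀ v, f v ≠ ⊤) (h0 : f j = 0)
    (h1 : ∀ v, v ≠ j → f v = 1 + ∑' w, G.stepDistribution v w * f w) (i : V) :
    G.expectedHittingTime i j = f i := by
  classical
  let : MeasurableSpace V := ⊤
  let μ := G.walkLaw i
  let φ : ∀ n : ℕ, (∀ _ : Finset.Iic n, V) → ℝ≥0∞ :=
    fun n y => if ∀ m, y m ≠ j then 1 else 0
  have hφ : ∀ n x, avoids j n x = φ n (frestrictLe n x) := by
    intro n x
    simp only [avoids, φ, frestrictLe_apply, Subtype.forall, Finset.mem_Iic]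
    congr 1
  have hmeas : ∀ n, Measurable (avoids j n) := by
    intro n
    have : avoids j n = φ n ∘ frestrictLe n := funext (hφ n)
    rw [this]
    exact Measurable.of_discrete.comp (measurable_frestrictLe n)
  have hmf : Measurable f := Measurable.of_discrete
  have hkernel : ∀ v, ∫⁻ w, f w ∂(G.stepKernel v) = ∑' w, G.stepDistribution v w * f w := by
    intro v
    rw [lintegral_countable']
    refine tsum_congr fun w => ?_
    rw [mul_comm]
    congr 1
    exact PMF.toMeasure_apply_singleton _ _ (MeasurableSet.of_discrete)
  -- `a n` is the probability of `T_j > n`, and `b n` is the expectation of `f (X_n)` on that event.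
  let a : ℕ → ℝ≥0∞ := fun n => ∫⁻ x, avoids j n x ∂μ
  let b : ℕ → ℝ≥0∞ := fun n => ∫⁻ x, avoids j n x * f (x n) ∂μ
  -- Apply `h1` at `X_n` on `T_j > n`. Restricting further to `T_j > n + 1` loses nothing, since `f`
  -- vanishes at `j`.
  have hrec : ∀ n, b (n + 1) + a n = b n := by
    intro n
    have e1 : b (n + 1) = ∫⁻ x, φ n (frestrictLe n x) * f (x (n + 1)) ∂μ := by
      refine lintegral_congr fun x => ?_
      rw [← hφ]
      by_cases hj : x (n + 1) = j
      · simp [hj, h0]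
      · congr 1
        have : (∀ m ≤ n + 1, x m ≠ j) ↔ ∀ m ≤ n, x m ≠ j := by
          constructor
          · exact fun h m hm => h m (by omega)
          · intro h m hm
            rcases Nat.lt_or_ge n m with h' | h'
            · obtain rfl : m = n + 1 := by omega
              exact hj
            · exact h m h'
        simp only [avoids, this]
    rw [e1, lintegral_walkLaw_succ, ← lintegral_add_left]
    · refine lintegral_congr fun x => ?_
      rw [← hφ, hkernel]
      by_cases hx : ∀ m ≤ n, x m ≠ j
      · rw [h1 (x n) (hx n le_rfl), mul_add, mul_one, add_comm]
      · simp [avoids, if_neg hx]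
    · have : Measurable fun v => ∫⁻ w, f w ∂(G.stepKernel v) := Measurable.of_discrete
      have h2 : Measurable (φ n) := Measurable.of_discrete
      fun_prop
  have hb0 : b 0 = f i := by
    have : ∀ᵐ x ∂μ, avoids j 0 x * f (x 0) = f i := by
      filter_upwards [G.ae_walkLaw_zero i] with x hx
      by_cases hij : i = j
      · simp [hx, hij, h0]
      · simp [avoids, hx, hij]
    simp only [b]
    rw [lintegral_congr_ae this, lintegral_const]
    simp [μ]
  have hsum : ∀ N, b N + ∑ n ∈ Finset.range N, a n = f i := by
    intro N
    induction N with
    | zero => simpa using hb0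
    | succ N ih => rw [Finset.sum_range_succ, add_comm _ (a N), ← add_assoc, hrec, ih]
  have hexp : G.expectedHittingTime i j = ∑' n, a n := by
    unfold expectedHittingTime
    simp only [hittingTime_eq_tsum]
    exact lintegral_tsum fun n => (hmeas n).aemeasurable
  have hle : ∑' n, a n ≤ f i := by
    rw [ENNReal.tsum_eq_iSup_nat]
    exact iSup_le fun N => (hsum N) ▸ le_add_self
  have hfin : ∑' n, a n ≠ ⊤ := ne_top_of_le_ne_top (hf i) hle
  -- The tail probabilities are summable, hence tend to zero. As `f` is bounded, so does `b`, and
  -- the telescoped identity `hsum` passes to the limit.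
  have ha : Tendsto a atTop (𝓝 0) := ENNReal.tendsto_atTop_zero_of_tsum_ne_top hfin
  have hC : ∃ C : ℝ≥0∞, C ≠ ⊤ ∧ ∀ v, f v ≤ C := by
    let := Fintype.ofFinite V
    refine ⟨∑ v, f v, ENNReal.sum_ne_top.2 fun v _ => hf v, fun v => ?_⟩
    exact Finset.single_le_sum (fun _ _ => zero_le) (Finset.mem_univ v)
  obtain ⟨C, hCt, hC⟩ := hC
  have hb : Tendsto b atTop (𝓝 0) := by
    have hCa : Tendsto (fun n => a n * C) atTop (𝓝 0) := by
      simpa using ENNReal.Tendsto.mul_const ha (Or.inr hCt)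
    refine tendsto_of_tendsto_of_tendsto_of_le_of_le tendsto_const_nhds hCa
      (fun _ => zero_le) fun n => ?_
    calc b n ≤ ∫⁻ x, avoids j n x * C ∂μ := lintegral_mono fun x => by gcongr; exact hC _
      _ = a n * C := lintegral_mul_const _ (hmeas n)
  have hlim : Tendsto (fun N => b N + ∑ n ∈ Finset.range N, a n) atTop (𝓝 (0 + ∑' n, a n)) :=
    hb.add ENNReal.summable.hasSum.tendsto_sum_nat
  simp only [hsum, zero_add] at hlim
  rw [hexp]
  exact tendsto_nhds_unique hlim tendsto_const_nhds |>.symm ▸ rfl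

end Walk

end SimpleGraph

/-! ### Hitting time equations on a finite connected graph -/

namespace SimpleGraph

section Dirichlet

open scoped Classical

variable {V : Type*} [Fintype V] {G : SimpleGraph V}

/-- The equations that determine the expected hitting times of `j`: `f` vanishes at `j`, and away
from `j` it exceeds its average over the neighbours by one. -/
structure IsHittingSolution (G : SimpleGraph V) (j : V) (f : V → ℝ) : Prop where
  apply_target : f j = 0
  sum_eq_zero : ∀ v, v ≠ j → ∑ w with G.Adj v w, (f v - f w - 1) = 0

/-- The minimum principle: a function that is superharmonic away from `j` and nonnegative at `j`
is nonnegative. -/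
theorem Connected.nonneg_of_superharmonic (hG : G.Connected) {j : V} {f : V → ℝ} (hj : 0 ≤ f j)
    (hf : ∀ v, v ≠ j → 0 ≤ ∑ w with G.Adj v w, (f v - f w)) (v : V) : 0 ≤ f v := by
  by_contra! hv
  obtain ⟨u, -, hu⟩ := Finset.exists_min_image Finset.univ f ⟨v, Finset.mem_univ v⟩
  have hmin : ∀ w, f u ≤ f w := fun w => hu w (Finset.mem_univ w)
  have hneg : f u < 0 := (hmin v).trans_lt hv
  -- At a vertex attaining the minimum all differences are nonpositive but their sum is nonnegative,
  -- so all vanish: the minimum spreads to the neighbours. Reaching `j` would make `f j` negative.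
  have hwalk : ∀ a b : V, G.Walk a b → f a = f u → f b = f u := by
    intro a b p
    induction p with
    | nil => exact id
    | @cons a c b hac p ih =>
      intro ha
      refine ih ?_
      have haj : a ≠ j := by rintro rfl; linarith
      have hle : ∀ w ∈ Finset.univ.filter (G.Adj a), f a - f w ≤ 0 := fun w _ => by
        linarith [hmin w]
      have h0 := (Finset.sum_eq_zero_iff_of_nonpos hle).1
        (le_antisymm (Finset.sum_nonpos hle) (hf a haj)) c (by simpa using hac)
      linarith
  obtain ⟨p⟩ := hG.preconnected u j
  linarith [hwalk u j p rfl]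

/-- The equations form a square linear system. The minimum principle applied to `f` and `-f` shows
that its kernel is trivial, so it is solvable. -/
theorem Connected.exists_isHittingSolution (hG : G.Connected) (j : V) :
    ∃ f, IsHittingSolution G j f := by
  let L : (V → ℝ) →ₗ[ℝ] (V → ℝ) :=
    { toFun := fun f v => if v = j then f j else ∑ w with G.Adj v w, (f v - f w)
      map_add' := by
        intro f g
        ext v
        by_cases h : v = j
        · simp [h]
        · simp only [h, if_false, Pi.add_apply, ← Finset.sum_add_distrib]
          exact Finset.sum_congr rfl fun w _ => by ring
      map_smul' := by
        intro c f
        ext v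
        by_cases h : v = j
        · simp [h]
        · simp only [h, if_false, Pi.smul_apply, smul_eq_mul, Finset.mul_sum, RingHom.id_apply]
          exact Finset.sum_congr rfl fun w _ => by ring }
  have hL : ∀ f v, L f v = if v = j then f j else ∑ w with G.Adj v w, (f v - f w) :=
    fun _ _ => rfl
  have hnn : ∀ f, L f = 0 → ∀ v, 0 ≤ f v := by
    intro f hf
    refine hG.nonneg_of_superharmonic (j := j) ?_ fun v hv => ?_
    · have := congrFun hf j
      rw [hL, if_pos rfl] at this
      simp [this]
    · have := congrFun hf v
      rw [hL, if_neg hv] at this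
      simp [this]
  have hinj : Function.Injective L := by
    rw [injective_iff_map_eq_zero]
    intro f hf
    ext v
    have h1 := hnn f hf v
    have h2 := hnn (-f) (by rw [map_neg, hf, neg_zero]) v
    simp only [Pi.neg_apply, Pi.zero_apply] at h2 ⊢
    linarith
  obtain ⟨f, hf⟩ := LinearMap.injective_iff_surjective.1 hinj
    fun v => if v = j then 0 else ((Finset.univ.filter (G.Adj v)).card : ℝ)
  refine ⟨f, ?_, fun v hv => ?_⟩
  · have := congrFun hf j
    rwa [hL, if_pos rfl, if_pos rfl] at this
  · have := congrFun hf v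
    rw [hL, if_neg hv, if_neg hv] at this
    rw [Finset.sum_sub_distrib, this]
    simp

theorem IsHittingSolution.nonneg {j : V} {f : V → ℝ} (hf : IsHittingSolution G j f)
    (hG : G.Connected) (v : V) : 0 ≤ f v := by
  refine hG.nonneg_of_superharmonic hf.apply_target.ge (fun v hv => ?_) v
  have := hf.sum_eq_zero v hv
  rw [Finset.sum_sub_distrib] at this
  have h2 : (0 : ℝ) ≤ ∑ w with G.Adj v w, (1 : ℝ) := Finset.sum_nonneg fun _ _ => zero_le_one
  linarith

theorem tsum_stepDistribution_mul {v : V} (hv : (G.neighborSet v).Nonempty) (f : V → ℝ≥0∞) :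
    ∑' w, G.stepDistribution v w * f w
      = ((Finset.univ.filter (G.Adj v)).card : ℝ≥0∞)⁻¹ * ∑ w with G.Adj v w, f w := by
  have hs : (Set.toFinite (G.neighborSet v)).toFinset = Finset.univ.filter (G.Adj v) := by
    ext w; simp
  rw [tsum_fintype, Finset.mul_sum, Finset.sum_filter]
  refine Finset.sum_congr rfl fun w _ => ?_
  rw [stepDistribution, dif_pos hv, PMF.uniformOfFinset_apply, hs]
  by_cases hw : G.Adj v w <;> simp [hw]

/-- A solution of the hitting time equations on a connected graph is the expected hitting time. -/
theorem IsHittingSolution.expectedHittingTime_eq {j : V} {f : V → ℝ}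
    (hf : IsHittingSolution G j f) (hG : G.Connected) (i : V) :
    G.expectedHittingTime i j = ENNReal.ofReal (f i) := by
  refine expectedHittingTime_eq_of_step G j (fun v => ENNReal.ofReal (f v))
    (fun _ => ENNReal.ofReal_ne_top) (by simp [hf.apply_target]) (fun v hv => ?_) i
  -- Since `v ≠ j`, connectedness rules out isolated vertices, so the stay-put convention plays no
  -- role.
  have hne : (G.neighborSet v).Nonempty := by
    have : Nontrivial V := ⟨v, j, hv⟩
    exact hG.preconnected.exists_adj_of_nontrivial v
  have hd : 0 < (Finset.univ.filter (G.Adj v)).card := by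
    obtain ⟨w, hw⟩ := hne
    exact Finset.card_pos.2 ⟨w, by simpa using hw⟩
  have hd' : (0 : ℝ) < ((Finset.univ.filter (G.Adj v)).card : ℝ) := by exact_mod_cast hd
  rw [tsum_stepDistribution_mul hne, ← ENNReal.ofReal_sum_of_nonneg fun w _ => hf.nonneg hG w,
    ← ENNReal.ofReal_natCast, ← ENNReal.ofReal_inv_of_pos hd',
    ← ENNReal.ofReal_mul (inv_nonneg.2 hd'.le), ← ENNReal.ofReal_one,
    ← ENNReal.ofReal_add zero_le_one
      (mul_nonneg (inv_nonneg.2 hd'.le) (Finset.sum_nonneg fun w _ => hf.nonneg hG w))]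
  congr 1
  have := hf.sum_eq_zero v hv
  simp only [Finset.sum_sub_distrib, Finset.sum_const, nsmul_eq_mul, mul_one] at this
  field_simp
  linarith

theorem IsHittingSolution.hit_eq {j : V} {f : V → ℝ} (hf : IsHittingSolution G j f)
    (hG : G.Connected) (i : V) : G.hit i j = f i := by
  rw [hit, hf.expectedHittingTime_eq hG, ENNReal.toReal_ofReal (hf.nonneg hG i)]

theorem Connected.isHittingSolution_hit (hG : G.Connected) (j : V) :
    IsHittingSolution G j fun i => G.hit i j := by
  obtain ⟨f, hf⟩ := hG.exists_isHittingSolution j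
  have : (fun i => G.hit i j) = f := funext fun i => hf.hit_eq hG i
  rwa [this]

theorem Connected.expectedHittingTime_ne_top (hG : G.Connected) (i j : V) :
    G.expectedHittingTime i j ≠ ⊤ := by
  obtain ⟨f, hf⟩ := hG.exists_isHittingSolution j
  rw [hf.expectedHittingTime_eq hG]
  exact ENNReal.ofReal_ne_top

/-- The discrepancy of the hitting time equation at the target, which encodes the mean return
time of a vertex. -/
theorem IsHittingSolution.sum_target {j : V} {f : V → ℝ} (hf : IsHittingSolution G j f) :
    ∑ w with G.Adj j w, (f j - f w - 1) = -(2 * (G.edgeSet.ncard : ℝ)) := by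
  -- Sum the equations over all vertices: only the target's term survives. The differences cancel by
  -- antisymmetry, and `-1` is counted once per ordered adjacent pair.
  have h1 : ∑ v, ∑ w with G.Adj v w, (f v - f w - 1)
      = ∑ w with G.Adj j w, (f j - f w - 1) :=
    Finset.sum_eq_single j (fun v _ hv => hf.sum_eq_zero v hv) fun h => absurd (Finset.mem_univ j) h
  have h2 : ∑ v, ∑ w with G.Adj v w, (f v - f w) = 0 := by
    have hanti : ∑ v, ∑ w with G.Adj v w, (f v - f w)
        = -∑ v, ∑ w with G.Adj v w, (f v - f w) := by
      simp only [Finset.sum_filter]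
      conv_lhs => rw [Finset.sum_comm]
      simp only [← Finset.sum_neg_distrib]
      refine Finset.sum_congr rfl fun v _ => Finset.sum_congr rfl fun w _ => ?_
      by_cases h : G.Adj v w
      · simp [h, h.symm]
      · simp [h, G.adj_comm w v]
    linarith
  have h3 : ∑ v, ∑ w with G.Adj v w, (1 : ℝ) = 2 * (G.edgeSet.ncard : ℝ) := by
    have := G.sum_degrees_eq_twice_card_edges
    have hc : G.edgeSet.ncard = G.edgeFinset.card := by
      rw [Set.ncard_eq_toFinset_card', edgeFinset]
    rw [hc, ← Nat.cast_ofNat, ← Nat.cast_mul, ← this, Nat.cast_sum]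
    refine Finset.sum_congr rfl fun v _ => ?_
    rw [Finset.sum_const, nsmul_eq_mul, mul_one, ← card_neighborFinset_eq_degree,
      neighborFinset_eq_filter]
  rw [← h1]
  simp only [Finset.sum_sub_distrib] at h2 ⊢
  rw [h2, h3]
  ring

/-- An equation valid at every `u`, target included, so that hitting times of different targets can
be combined linearly. -/
theorem Connected.sum_hit_sub_hit (hG : G.Connected) (u s : V) :
    ∑ w with G.Adj u w, (G.hit u s - G.hit w s - 1)
      = if u = s then -(2 * (G.edgeSet.ncard : ℝ)) else 0 := by
  split_ifs with h
  · subst h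
    exact (hG.isHittingSolution_hit u).sum_target
  · exact (hG.isHittingSolution_hit s).sum_eq_zero u h

theorem Connected.hit_self (hG : G.Connected) (j : V) : G.hit j j = 0 :=
  (hG.isHittingSolution_hit j).apply_target

end Dirichlet

end SimpleGraph

/-! ### Solutions on the parallel subdivision -/

namespace SimpleGraph

section Subdivision

variable {V : Type*} {G : SimpleGraph V} {k : ℕ}

@[simp]
theorem parallelSubdivision_adj_inl_inr {v : V} {x : G.edgeSet × Fin k} :
    (G.parallelSubdivision k).Adj (Sum.inl v) (Sum.inr x) ↔ v ∈ (x.1 : Sym2 V) := Iff.rfl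

@[simp]
theorem parallelSubdivision_adj_inr_inl {v : V} {x : G.edgeSet × Fin k} :
    (G.parallelSubdivision k).Adj (Sum.inr x) (Sum.inl v) ↔ v ∈ (x.1 : Sym2 V) := Iff.rfl

@[simp]
theorem parallelSubdivision_not_adj_inl_inl {v w : V} :
    ¬(G.parallelSubdivision k).Adj (Sum.inl v) (Sum.inl w) := id

@[simp]
theorem parallelSubdivision_not_adj_inr_inr {x y : G.edgeSet × Fin k} :
    ¬(G.parallelSubdivision k).Adj (Sum.inr x) (Sum.inr y) := id

theorem Connected.parallelSubdivision (hG : G.Connected) (hk : 1 ≤ k) :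
    (G.parallelSubdivision k).Connected := by
  have hinl : ∀ u v : V, (G.parallelSubdivision k).Reachable (Sum.inl u) (Sum.inl v) := by
    intro u v
    obtain ⟨p⟩ := hG.preconnected u v
    induction p with
    | nil => exact Reachable.refl _
    | @cons u w v h p ih =>
      -- The copy numbered `0` exists because `1 ≤ k`.
      let x : G.edgeSet × Fin k := (⟨s(u, w), h⟩, ⟨0, hk⟩)
      have h1 : (G.parallelSubdivision k).Adj (Sum.inl u) (Sum.inr x) := Sym2.mem_mk_left u w
      have h2 : (G.parallelSubdivision k).Adj (Sum.inr x) (Sum.inl w) := Sym2.mem_mk_right u w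
      exact h1.reachable.trans (h2.reachable.trans ih)
  obtain ⟨v₀⟩ := hG.nonempty
  rw [connected_iff_exists_forall_reachable]
  refine ⟨Sum.inl v₀, ?_⟩
  rintro (v | x)
  · exact hinl v₀ v
  · have h : (G.parallelSubdivision k).Adj (Sum.inl (x.1 : Sym2 V).out.1) (Sum.inr x) :=
      Sym2.out_fst_mem _
    exact (hinl v₀ _).trans h.reachable

/-- The two neighbours of a new vertex are distinct, and they are the ends of its edge. -/
theorem ends_of_neighborSet_parallelSubdivision {x : G.edgeSet × Fin k} {s t : V}
    (h : (G.parallelSubdivision k).neighborSet (Sum.inr x) = {Sum.inl s, Sum.inl t}) :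
    s ≠ t ∧ (x.1 : Sym2 V) = s(s, t) := by
  have hmem : ∀ v, v ∈ (x.1 : Sym2 V) ↔ v = s ∨ v = t := by
    intro v
    rw [← parallelSubdivision_adj_inr_inl, ← mem_neighborSet, h]
    simp
  -- A single neighbour would make the underlying edge a loop.
  have hne : s ≠ t := by
    rintro rfl
    obtain ⟨⟨e, he⟩, c⟩ := x
    induction e with
    | _ a b =>
      have ha := (hmem a).1 (Sym2.mem_mk_left a b)
      have hb := (hmem b).1 (Sym2.mem_mk_right a b)
      rw [or_self] at ha hb
      exact G.ne_of_adj he (ha.trans hb.symm)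
  exact ⟨hne, (Sym2.mem_and_mem_iff hne).1 ⟨(hmem s).2 (Or.inl rfl), (hmem t).2 (Or.inr rfl)⟩⟩

/-- The extension of a function on the vertices of `G` to the new vertices of `S_k(G)` that
exceeds by one, at every new vertex, the average over the two ends. -/
noncomputable def subdivisionExtend (G : SimpleGraph V) (k : ℕ) (a : V → ℝ) :
    V ⊕ (G.edgeSet × Fin k) → ℝ
  | Sum.inl v => a v
  | Sum.inr x => Sym2.lift ⟨fun s t => 1 + (a s + a t) / 2, fun s t => by ring⟩ (x.1 : Sym2 V)

theorem subdivisionExtend_inr (a : V → ℝ) {x : G.edgeSet × Fin k} {s t : V}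
    (h : (x.1 : Sym2 V) = s(s, t)) :
    subdivisionExtend G k a (Sum.inr x) = 1 + (a s + a t) / 2 := by
  rw [subdivisionExtend, h, Sym2.lift_mk]

open scoped Classical

variable [Fintype V]

theorem sum_edges_mem (u : V) (g : Sym2 V → ℝ) :
    ∑ e : G.edgeSet, (if u ∈ (e : Sym2 V) then g e else 0) = ∑ w with G.Adj u w, g s(u, w) := by
  rw [← Finset.sum_filter]
  symm
  refine Finset.sum_bij (fun w hw => ⟨s(u, w), (Finset.mem_filter.1 hw).2⟩) ?_ ?_ ?_ ?_
  · intro w hw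
    simp
  · intro w hw w' hw' h
    exact Sym2.congr_right.1 (congrArg Subtype.val h)
  · rintro ⟨e, he⟩ hu
    obtain ⟨w, rfl⟩ := Sym2.mem_iff_exists.1 (Finset.mem_filter.1 hu).2
    exact ⟨w, Finset.mem_filter.2 ⟨Finset.mem_univ w, he⟩, rfl⟩
  · intro w hw
    rfl

/-- Each `G`-neighbour `w` of `u` yields `k` new vertices, each contributing `a u - (1 + (a u + a w)
/ 2) - 1 = (a u - a w - 4) / 2`. -/
theorem sum_subdivisionExtend_inl (a : V → ℝ) (u : V) :
    ∑ y with (G.parallelSubdivision k).Adj (Sum.inl u) y,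
        (subdivisionExtend G k a (Sum.inl u) - subdivisionExtend G k a y - 1)
      = k / 2 * ∑ w with G.Adj u w, (a u - a w - 4) := by
  let g : Sym2 V → ℝ := fun e =>
    a u - Sym2.lift ⟨fun s t => 1 + (a s + a t) / 2, fun s t => by ring⟩ e - 1
  have h := sum_edges_mem (G := G) u g
  rw [Finset.sum_filter, Fintype.sum_sum_type, Fintype.sum_prod_type]
  simp only [parallelSubdivision_not_adj_inl_inl, if_false, Finset.sum_const_zero, zero_add,
    parallelSubdivision_adj_inl_inr, Finset.sum_const, Finset.card_univ, Fintype.card_fin,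
    nsmul_eq_mul, ← Finset.mul_sum, subdivisionExtend]
  change (k : ℝ) * ∑ e : G.edgeSet, (if u ∈ (e : Sym2 V) then g e else 0) = _
  rw [h, div_mul_eq_mul_div, mul_div_assoc, Finset.sum_div]
  congr 1
  refine Finset.sum_congr rfl fun w _ => ?_
  simp only [g, Sym2.lift_mk]
  ring

theorem sum_subdivision_inr {x : G.edgeSet × Fin k} {s t : V} (hne : s ≠ t)
    (h : (x.1 : Sym2 V) = s(s, t)) (f : V ⊕ (G.edgeSet × Fin k) → ℝ) :
    ∑ y with (G.parallelSubdivision k).Adj (Sum.inr x) y, f y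
      = f (Sum.inl s) + f (Sum.inl t) := by
  have : Finset.univ.filter ((G.parallelSubdivision k).Adj (Sum.inr x))
      = {Sum.inl s, Sum.inl t} := by
    ext (v | y) <;> simp [h]
  rw [this, Finset.sum_pair (by simpa using hne)]

theorem sum_subdivisionExtend_inr (a : V → ℝ) (x : G.edgeSet × Fin k) :
    ∑ y with (G.parallelSubdivision k).Adj (Sum.inr x) y,
        (subdivisionExtend G k a (Sum.inr x) - subdivisionExtend G k a y - 1) = 0 := by
  obtain ⟨s, t, h⟩ : ∃ s t, (x.1 : Sym2 V) = s(s, t) := by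
    induction (x.1 : Sym2 V) with
    | _ a b => exact ⟨a, b, rfl⟩
  have hadj : G.Adj s t := by
    have := x.1.2
    rwa [h] at this
  rw [sum_subdivision_inr hadj.ne h, subdivisionExtend_inr a h]
  simp only [subdivisionExtend]
  ring

theorem Connected.isHittingSolution_inl (hG : G.Connected) (j : V) :
    IsHittingSolution (G.parallelSubdivision k) (Sum.inl j)
      (subdivisionExtend G k fun v => 4 * G.hit v j) := by
  refine ⟨by simp [subdivisionExtend, hG.hit_self], ?_⟩
  rintro (u | x) hu
  · rw [sum_subdivisionExtend_inl]
    have h := hG.sum_hit_sub_hit u j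
    rw [if_neg (by simpa using hu)] at h
    have : ∑ w with G.Adj u w, (4 * G.hit u j - 4 * G.hit w j - 4)
        = 4 * ∑ w with G.Adj u w, (G.hit u j - G.hit w j - 1) := by
      rw [Finset.mul_sum]
      exact Finset.sum_congr rfl fun w _ => by ring
    rw [this, h, mul_zero, mul_zero]
  · exact sum_subdivisionExtend_inr _ x

/-- The values at the original vertices of the expected hitting time of a new vertex with
ends `s` and `t`. -/
noncomputable def hitNew (G : SimpleGraph V) (k : ℕ) (s t v : V) : ℝ :=
  2 * (k : ℝ) * (G.edgeSet.ncard : ℝ) - 1 + 2 * (G.hit v s + G.hit v t) - (G.hit t s + G.hit s t)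

/-- The correction at `x` is seen only from its ends, where it adds `2km` and cancels the defect `(k
/ 2) * 2 * (-2m)` of the extended function. -/
theorem Connected.isHittingSolution_inr (hG : G.Connected) {x : G.edgeSet × Fin k} {s t : V}
    (hne : s ≠ t) (hx : (x.1 : Sym2 V) = s(s, t)) :
    IsHittingSolution (G.parallelSubdivision k) (Sum.inr x)
      (fun y => subdivisionExtend G k (hitNew G k s t) y
        - if y = Sum.inr x then 2 * (k : ℝ) * (G.edgeSet.ncard : ℝ) else 0) := by
  refine ⟨?_, ?_⟩
  -- The constant in `hitNew` is the one for which this value vanishes.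
  · simp only [subdivisionExtend_inr _ hx, if_pos, hitNew, hG.hit_self]
    ring
  rintro (u | y) hy
  · set C : ℝ := 2 * (k : ℝ) * (G.edgeSet.ncard : ℝ) with hC
    have hsplit : ∑ y with (G.parallelSubdivision k).Adj (Sum.inl u) y,
        ((subdivisionExtend G k (hitNew G k s t) (Sum.inl u)
            - if (Sum.inl u : V ⊕ (G.edgeSet × Fin k)) = Sum.inr x then C else 0)
          - (subdivisionExtend G k (hitNew G k s t) y - if y = Sum.inr x then C else 0) - 1)
        = ∑ y with (G.parallelSubdivision k).Adj (Sum.inl u) y,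
            (subdivisionExtend G k (hitNew G k s t) (Sum.inl u)
              - subdivisionExtend G k (hitNew G k s t) y - 1)
          + ∑ y with (G.parallelSubdivision k).Adj (Sum.inl u) y,
            (if y = Sum.inr x then C else 0) := by
      rw [← Finset.sum_add_distrib]
      refine Finset.sum_congr rfl fun y _ => ?_
      rw [if_neg (by simp)]
      ring
    rw [hsplit, sum_subdivisionExtend_inl, Finset.sum_ite_eq']
    have hsum : ∑ w with G.Adj u w, (hitNew G k s t u - hitNew G k s t w - 4)
        = 2 * ∑ w with G.Adj u w, (G.hit u s - G.hit w s - 1)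
          + 2 * ∑ w with G.Adj u w, (G.hit u t - G.hit w t - 1) := by
      rw [Finset.mul_sum, Finset.mul_sum, ← Finset.sum_add_distrib]
      refine Finset.sum_congr rfl fun w _ => ?_
      simp only [hitNew]
      ring
    rw [hsum, hG.sum_hit_sub_hit, hG.sum_hit_sub_hit]
    simp only [Finset.mem_filter, Finset.mem_univ, true_and, parallelSubdivision_adj_inl_inr, hx,
      Sym2.mem_iff]
    by_cases hus : u = s
    · have hut : u ≠ t := fun h => hne (hus.symm.trans h)
      simp only [hus, hne, if_true, if_false, true_or, hC]
      ring
    · by_cases hut : u = t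
      · simp only [hut, hne.symm, if_true, if_false, or_true, hC]
        ring
      · simp [hus, hut]
  -- New vertices are not adjacent to one another, so the correction at `x` does not affect the
  -- equation at `y`.
  · rw [if_neg hy]
    rw [← sum_subdivisionExtend_inr (hitNew G k s t) y]
    refine Finset.sum_congr rfl fun z hz => ?_
    have hz' : z ≠ Sum.inr x := by
      rintro rfl
      exact absurd (Finset.mem_filter.1 hz).2 parallelSubdivision_not_adj_inr_inr
    rw [if_neg hz']
    ring

/-- The expected hitting times of an original vertex in `S_k(G)`. -/
theorem Connected.hit_parallelSubdivision_inl (hG : G.Connected) (hk : 1 ≤ k) (j : V)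
    (y : V ⊕ (G.edgeSet × Fin k)) :
    (G.parallelSubdivision k).hit y (Sum.inl j)
      = subdivisionExtend G k (fun v => 4 * G.hit v j) y :=
  (hG.isHittingSolution_inl j).hit_eq (hG.parallelSubdivision hk) y

/-- The expected hitting time of a new vertex from an original vertex. -/
theorem Connected.hit_parallelSubdivision_inl_inr (hG : G.Connected) (hk : 1 ≤ k) {s t : V}
    {i : G.edgeSet × Fin k} (j : V)
    (hi : (G.parallelSubdivision k).neighborSet (Sum.inr i) = {Sum.inl s, Sum.inl t}) :
    (G.parallelSubdivision k).hit (Sum.inl j) (Sum.inr i) = hitNew G k s t j := by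
  obtain ⟨hst, hi⟩ := ends_of_neighborSet_parallelSubdivision hi
  rw [(hG.isHittingSolution_inr hst hi).hit_eq (hG.parallelSubdivision hk), if_neg (by simp),
    sub_zero, subdivisionExtend]

/-- The expected hitting time of a new vertex from another new vertex. -/
theorem Connected.hit_parallelSubdivision_inr_inr (hG : G.Connected) (hk : 1 ≤ k) {s t p q : V}
    {i j : G.edgeSet × Fin k} (hij : i ≠ j)
    (hi : (G.parallelSubdivision k).neighborSet (Sum.inr i) = {Sum.inl s, Sum.inl t})
    (hj : (G.parallelSubdivision k).neighborSet (Sum.inr j) = {Sum.inl p, Sum.inl q}) :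
    (G.parallelSubdivision k).hit (Sum.inr i) (Sum.inr j)
      = 2 * (k : ℝ) * (G.edgeSet.ncard : ℝ)
        + G.hit s p + G.hit s q + G.hit t p + G.hit t q - G.hit q p - G.hit p q := by
  obtain ⟨-, hi⟩ := ends_of_neighborSet_parallelSubdivision hi
  obtain ⟨hpq, hj⟩ := ends_of_neighborSet_parallelSubdivision hj
  rw [(hG.isHittingSolution_inr hpq hj).hit_eq (hG.parallelSubdivision hk),
    if_neg (by simpa using hij), subdivisionExtend_inr _ hi]
  simp only [hitNew]
  ring

end Subdivision

end SimpleGraph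
theorem mainTheorem3 {V : Type*} [Finite V] (G : SimpleGraph V) (hG : G.Connected)
    (k : ℕ) (hk : 1 ≤ k) :
    -- all the expected hitting times involved are finite
    (∀ i j : V, G.expectedHittingTime i j ≠ ⊤) ∧
    (∀ x y : V ⊕ (G.edgeSet × Fin k), (G.parallelSubdivision k).expectedHittingTime x y ≠ ⊤) ∧
    -- two original vertices
    (∀ i j : V, (G.parallelSubdivision k).hit (Sum.inl i) (Sum.inl j) = 4 * G.hit i j) ∧
    -- a new vertex and an original vertex
    (∀ (i : G.edgeSet × Fin k) (j s t : V),
      (G.parallelSubdivision k).neighborSet (Sum.inr i) = {Sum.inl s, Sum.inl t} →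
        (G.parallelSubdivision k).hit (Sum.inr i) (Sum.inl j)
            = 1 + 2 * G.hit s j + 2 * G.hit t j ∧
        (G.parallelSubdivision k).hit (Sum.inl j) (Sum.inr i)
            = 2 * (k : ℝ) * (G.edgeSet.ncard : ℝ) - 1 + 2 * (G.hit j s + G.hit j t)
              - (G.hit t s + G.hit s t)) ∧
    -- two distinct new vertices
    (∀ (i j : G.edgeSet × Fin k) (s t p q : V), i ≠ j →
      (G.parallelSubdivision k).neighborSet (Sum.inr i) = {Sum.inl s, Sum.inl t} →
      (G.parallelSubdivision k).neighborSet (Sum.inr j) = {Sum.inl p, Sum.inl q} →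
        (G.parallelSubdivision k).hit (Sum.inr i) (Sum.inr j)
            = 2 * (k : ℝ) * (G.edgeSet.ncard : ℝ)
              + G.hit s p + G.hit s q + G.hit t p + G.hit t q - G.hit q p - G.hit p q ∧
        (G.parallelSubdivision k).hit (Sum.inr j) (Sum.inr i)
            = 2 * (k : ℝ) * (G.edgeSet.ncard : ℝ)
              + G.hit p s + G.hit q s + G.hit p t + G.hit q t - G.hit t s - G.hit s t) := by
  classical
  have := Fintype.ofFinite V
  have hS := hG.parallelSubdivision hk
  refine ⟨hG.expectedHittingTime_ne_top, hS.expectedHittingTime_ne_top,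
    fun i j => hG.hit_parallelSubdivision_inl hk j _, fun i j s t hi => ⟨?_, ?_⟩,
    fun i j s t p q hij hi hj => ⟨?_, ?_⟩⟩
  · rw [hG.hit_parallelSubdivision_inl hk, SimpleGraph.subdivisionExtend_inr _
      (SimpleGraph.ends_of_neighborSet_parallelSubdivision hi).2]
    ring
  · exact hG.hit_parallelSubdivision_inl_inr hk j hi
  · exact hG.hit_parallelSubdivision_inr_inr hk hij hi hj
  · rw [hG.hit_parallelSubdivision_inr_inr hk hij.symm hj hi]
    ring
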